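/- Let $\Delta$ be a simplicial complex on a finite vertex set $V$ with at least one nonempty face, and let $\mathbb K$ be a field. By a subcomplex of $\Delta$ we mean a simplicial complex all of whose facets (inclusion-maximal faces) are facets of $\Delta$. A facet $F$ of $\Delta$ is a leaf if either $F$ is the only facet of $\Delta$, or there is a facet $G\neq F$ such that $F\cap H\subseteq F\cap G$ for all facets $H\neq F$. The complex $\Delta$ is a simplicial forest if every connected component of $\Delta$ is a simplicial tree, i.e. a connected simplicial complex all of whose nonempty subcomplexes have a leaf. The facet ideal of $\Delta$ is the ideal $I(\Delta)=\langle \prod_{i\in F}x_i \mid F \text{ a facet of } \Delta\rangle$ of the polynomial ring $R=\mathbb K[x_i\mid i\in V]$, and $\Delta$ is called Cohen–Macaulay (over $\mathbb K$) if $R/I(\Delta)$ is Cohen–Macaulay, i.e. $\operatorname{depth}(R/I(\Delta))=\dim (R/I(\Delta))$, where the depth is taken with respect to the ideal generated by the variables. A special leaf of $\Delta$ is a leaf $F$ such that for all facets $H,H'$ of $\Delta$ different from $F$, $$(H\cap H')\setminus F\neq\emptyset \iff H\cap H'\neq\emptyset .$$ **Lemma.** If $\Delta$ is a Cohen–Macaulay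 simplicial forest, then $\Delta$ has at least one special leaf. -/

import Mathlib

/-! Simplicial complexes are Mathlib's `PreAbstractSimplicialComplex V`: downward closed families of
nonempty finite subsets of `V` (the empty face is left implicit, and not every point of `V` has to
be a vertex). -/

namespace PreAbstractSimplicialComplex

variable {V : Type*}

/-- The facets of a simplicial complex: its inclusion-maximal faces. -/
def facets (Δ : PreAbstractSimplicialComplex V) : Set (Finset V) :=
  {F | Maximal (fun G => G ∈ Δ) F}

/-- A subcomplex, in the sense used for facet complexes: a simplicial complex all of whose facets
are facets of `Δ`. -/
def IsSubcomplex (Γ Δ : PreAbstractSimplicialComplex V) : Prop :=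
  Γ.facets ⊆ Δ.facets

variable [DecidableEq V]

/-- `F` is a leaf of `Δ`: a facet which is the only facet of `Δ`, or for which there is a facet
`G ≠ F` (a joint of `F`) such that `F ∩ H ⊆ F ∩ G` for all facets `H ≠ F`. -/
def IsLeaf (Δ : PreAbstractSimplicialComplex V) (F : Finset V) : Prop :=
  F ∈ Δ.facets ∧
    (Δ.facets = {F} ∨
      ∃ G ∈ Δ.facets, G ≠ F ∧ ∀ H ∈ Δ.facets, H ≠ F → F ∩ H ⊆ F ∩ G)

/-- `F` is a special leaf of `Δ`: a leaf such that for all facets `H`, `H'` other than `F`,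
`(H ∩ H') \ F` is nonempty if and only if `H ∩ H'` is nonempty. -/
def IsSpecialLeaf (Δ : PreAbstractSimplicialComplex V) (F : Finset V) : Prop :=
  Δ.IsLeaf F ∧
    ∀ H ∈ Δ.facets, ∀ H' ∈ Δ.facets, H ≠ F → H' ≠ F →
      (((H ∩ H') \ F).Nonempty ↔ (H ∩ H').Nonempty)

/-- `Δ` is connected: it is nonempty and any two facets are joined by a chain of facets in which
consecutive ones intersect. -/
def IsConnected (Δ : PreAbstractSimplicialComplex V) : Prop :=
  Δ.faces.Nonempty ∧
    ∀ F ∈ Δ.facets, ∀ G ∈ Δ.facets,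
      Relation.ReflTransGen (fun H H' => H ∈ Δ.facets ∧ H' ∈ Δ.facets ∧ (H ∩ H').Nonempty) F G

/-- `C` is a connected component of `Δ`: a maximal connected subcomplex. -/
def IsConnectedComponent (C Δ : PreAbstractSimplicialComplex V) : Prop :=
  Maximal (fun Γ : PreAbstractSimplicialComplex V => Γ.IsSubcomplex Δ ∧ Γ.IsConnected) C

/-- A simplicial tree: a connected simplicial complex every nonempty subcomplex of which has a
leaf. -/
def IsSimplicialTree (Δ : PreAbstractSimplicialComplex V) : Prop :=
  Δ.IsConnected ∧
    ∀ Γ : PreAbstractSimplicialComplex V, Γ.IsSubcomplex Δ → Γ.faces.Nonempty → ∃ F, Γ.IsLeaf F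

/-- A simplicial forest: a simplicial complex every connected component of which is a simplicial
tree. -/
def IsSimplicialForest (Δ : PreAbstractSimplicialComplex V) : Prop :=
  ∀ C : PreAbstractSimplicialComplex V, C.IsConnectedComponent Δ → C.IsSimplicialTree

end PreAbstractSimplicialComplex

/-- The facet ideal `I(Δ)` in the polynomial ring over `K` with variables indexed by `V`: it is
generated by the square-free monomials `∏ i ∈ F, X i`, for `F` a facet of `Δ`. -/
noncomputable def PreAbstractSimplicialComplex.facetIdeal {V : Type*} (K : Type*) [Field K]
    (Δ : PreAbstractSimplicialComplex V) : Ideal (MvPolynomial V K) :=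
  Ideal.span ((fun F : Finset V => ∏ i ∈ F, (MvPolynomial.X i : MvPolynomial V K)) '' Δ.facets)

/-- The depth of the `R`-module `R / I` with respect to an ideal `m` of `R`: the supremum of the
lengths of the `R / I`-regular sequences consisting of elements of `m`. -/
noncomputable def quotientDepth {R : Type*} [CommRing R] (m I : Ideal R) : ℕ∞ :=
  ⨆ (rs : List R) (_ : ∀ r ∈ rs, r ∈ m) (_ : RingTheory.Sequence.IsRegular (R ⧸ I) rs),
    (rs.length : ℕ∞)

/-- For a proper homogeneous ideal `I` of the polynomial ring `R = K[V]` in finitely many variables,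
`R / I` is Cohen-Macaulay if its depth with respect to the maximal ideal generated by the variables
equals its Krull dimension. -/
def IsCohenMacaulayQuotient {V K : Type*} [Field K] (I : Ideal (MvPolynomial V K)) : Prop :=
  ((quotientDepth (MvPolynomial.idealOfVars V K) I : ℕ∞) : WithBot ℕ∞) =
    ringKrullDim (MvPolynomial V K ⧸ I)

/-! Cohen–Macaulayness enters only through unmixedness. A minimal vertex cover `C` gives an
associated prime of `R/I`, and depth is at most `dim R/P` for such a prime `P`, so depth = dim makes
all minimal covers equally small.

A forest has the König property: there is a matching `M` with a cover of the same size. By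
unmixedness every minimal cover has at most `|M|` points, so it lies in the union of `M` and meets
each member of `M` exactly once. Minimal covers avoiding well-chosen sets then show that `M`
partitions the vertices and that the traces of the facets on each `F ∈ M` form a chain
(`HasLeaves.exists_partition_of_unmixed`). The chain condition makes each such `F` a leaf.

To find a special one, replace each facet outside `M` by the set of members of `M` it meets. Leaves
survive this contraction, and no singleton arises. By `HasLeaves.exists_dominated` there are `A ≠ B`
in `M` such that every facet outside `M` meeting `A` also meets `B`. Two such facets then share a
point of `B`, by the chain condition there, and `B` is disjoint from `A`; hence `A` is special. -/

/-- A finite family of finite sets each nonempty subfamily of which has a leaf. -/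
def HasLeaves {α : Type*} [DecidableEq α] (S : Finset (Finset α)) : Prop :=
  ∀ T ⊆ S, T.Nonempty → ∃ F ∈ T, T = {F} ∨ ∃ G ∈ T, G ≠ F ∧ ∀ H ∈ T, H ≠ F → F ∩ H ⊆ G

/-- `C` meets every member of the family `S`. -/
def IsVertexCover {α : Type*} [DecidableEq α] (S : Finset (Finset α)) (C : Finset α) : Prop :=
  ∀ F ∈ S, (F ∩ C).Nonempty

/-! ### Combinatorics of families with leaves. -/

namespace HasLeaves

variable {α β : Type*} [DecidableEq α] [DecidableEq β] {S T : Finset (Finset α)}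

theorem mono (hS : HasLeaves S) (h : T ⊆ S) : HasLeaves T :=
  fun U hU => hS U (hU.trans h)

theorem insert_empty (hS : HasLeaves S) : HasLeaves (insert ∅ S) := by
  intro T hT hne
  by_cases h : ∅ ∈ T
  · refine ⟨∅, h, ?_⟩
    by_cases h1 : T = {∅}
    · exact Or.inl h1
    · right
      obtain ⟨G, hG, hG'⟩ : ∃ G ∈ T, G ≠ ∅ := by
        by_contra! hcon
        exact h1 (Finset.eq_singleton_iff_unique_mem.2 ⟨h, hcon⟩)
      exact ⟨G, hG, hG', fun H _ _ => by simp⟩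
  · refine hS T (fun F hF => ?_) hne
    rcases Finset.mem_insert.1 (hT hF) with rfl | h'
    · exact absurd hF h
    · exact h'

/-- Choose one preimage of each member of the subfamily; `hf` carries a leaf and its joint over to
the images. -/
theorem image (hS : HasLeaves S) (f : Finset α → Finset β)
    (hf : ∀ F ∈ S, ∀ G ∈ S, ∀ H ∈ S, F ∩ H ⊆ G → f F ∩ f H ⊆ f G) :
    HasLeaves (S.image f) := by
  intro T hT hne
  have hsurj : Set.SurjOn f (S : Set (Finset α)) (T : Set (Finset β)) := by
    intro y hy
    simpa using hT hy
  obtain ⟨U, hU, hinj, rfl⟩ := Finset.exists_subset_injOn_image_eq_of_surjOn _ _ hsurj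
  have hU' : U ⊆ S := by exact_mod_cast hU
  obtain ⟨F, hF, h⟩ := hS U hU' (by simpa using hne)
  refine ⟨f F, Finset.mem_image_of_mem f hF, ?_⟩
  rcases h with rfl | ⟨G, hG, hGF, h⟩
  · left; simp
  · right
    refine ⟨f G, Finset.mem_image_of_mem f hG, fun e => hGF (hinj hG hF e), ?_⟩
    intro H hH hne'
    obtain ⟨H, hH', rfl⟩ := Finset.mem_image.1 hH
    exact hf F (hU' hF) G (hU' hG) H (hU' hH') (h H hH' (fun e => hne' (e ▸ rfl)))

/-- The König property of simplicial forests. -/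
theorem exists_matching_cover (hS : HasLeaves S) (h0 : ∅ ∉ S) :
    ∃ M ⊆ S, ∃ C : Finset α, (∀ F ∈ M, ∀ G ∈ M, ∀ x ∈ F, x ∈ G → F = G) ∧
      IsVertexCover S C ∧ C.card ≤ M.card := by
  induction h : S.card using Nat.strong_induction_on generalizing S with
  | _ n ih =>
  subst h
  rcases S.eq_empty_or_nonempty with rfl | hne
  · exact ⟨∅, by simp, ∅, by simp, by simp [IsVertexCover], by simp⟩
  obtain ⟨F, hF, h⟩ := hS S subset_rfl hne
  obtain ⟨x, hx⟩ : F.Nonempty := Finset.nonempty_iff_ne_empty.2 (fun e => h0 (e ▸ hF))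
  have hrec : ∀ A ∈ S, ∃ M ⊆ S.erase A, ∃ C : Finset α,
      (∀ F ∈ M, ∀ G ∈ M, ∀ x ∈ F, x ∈ G → F = G) ∧
      IsVertexCover (S.erase A) C ∧ C.card ≤ M.card := fun A hA =>
    ih _ (Finset.card_erase_lt_of_mem hA) (hS.mono (Finset.erase_subset _ _))
      (fun h => h0 (Finset.mem_of_mem_erase h)) rfl
  -- A leaf disjoint from all other members joins the matching, and any of its points joins the
  -- cover.
  have isolated : (∀ H ∈ S, H ≠ F → F ∩ H = ∅) → ∃ M ⊆ S, ∃ C : Finset α,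
      (∀ F ∈ M, ∀ G ∈ M, ∀ x ∈ F, x ∈ G → F = G) ∧ IsVertexCover S C ∧ C.card ≤ M.card := by
    intro hiso
    obtain ⟨M, hM, C, hdis, hC, hcard⟩ := hrec F hF
    have hFH : ∀ H ∈ M, ∀ y ∈ F, y ∉ H := by
      intro H hH y hy hyH
      have hH' := Finset.mem_erase.1 (hM hH)
      have : y ∈ F ∩ H := Finset.mem_inter.2 ⟨hy, hyH⟩
      rw [hiso H hH'.2 hH'.1] at this
      simp at this
    refine ⟨insert F M, Finset.insert_subset hF (hM.trans (Finset.erase_subset _ _)),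
      insert x C, ?_, ?_, ?_⟩
    · intro A hA B hB y hyA hyB
      rcases Finset.mem_insert.1 hA with rfl | hA' <;>
        rcases Finset.mem_insert.1 hB with rfl | hB'
      · rfl
      · exact absurd hyB (hFH B hB' y hyA)
      · exact absurd hyA (hFH A hA' y hyB)
      · exact hdis A hA' B hB' y hyA hyB
    · intro A hA
      by_cases hAF : A = F
      · subst hAF
        exact ⟨x, by simp [hx]⟩
      · exact (hC A (Finset.mem_erase.2 ⟨hAF, hA⟩)).mono
          (Finset.inter_subset_inter subset_rfl (Finset.subset_insert _ _))
    · rw [Finset.card_insert_of_notMem (s := M) (fun h => by simpa using hM h)]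
      exact (Finset.card_insert_le _ _).trans (by lia)
  rcases h with rfl | ⟨G, hG, hGF, h⟩
  · exact isolated (fun H hH hne => absurd (Finset.mem_singleton.1 hH) hne)
  rcases (F ∩ G).eq_empty_or_nonempty with hFG | ⟨g, hg⟩
  · refine isolated (fun H hH hne => ?_)
    have : F ∩ H ⊆ F ∩ G := Finset.subset_inter Finset.inter_subset_left (h H hH hne)
    rw [hFG] at this
    exact Finset.subset_empty.1 this
  rw [Finset.mem_inter] at hg
  -- Remove the joint rather than the leaf: the matching is kept, and only `G` may need covering. If
  -- the point `c` of `C` in `F` is not in `G`, then among the remaining members only `F` contains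
  -- it, so it can be traded for `g ∈ F ∩ G`.
  obtain ⟨M, hM, C, hdis, hC, hcard⟩ := hrec G hG
  refine ⟨M, hM.trans (Finset.erase_subset _ _), ?_⟩
  obtain ⟨c, hc⟩ := hC F (Finset.mem_erase.2 ⟨hGF.symm, hF⟩)
  rw [Finset.mem_inter] at hc
  by_cases hcG : c ∈ G
  · refine ⟨C, hdis, fun A hA => ?_, hcard⟩
    by_cases hAG : A = G
    · exact ⟨c, by simp [hAG, hcG, hc.2]⟩
    · exact hC A (Finset.mem_erase.2 ⟨hAG, hA⟩)
  · refine ⟨insert g (C.erase c), hdis, fun A hA => ?_, ?_⟩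
    · by_cases hAG : A = G
      · exact ⟨g, by simp [hAG, hg.2]⟩
      by_cases hAF : A = F
      · exact ⟨g, by simp [hAF, hg.1]⟩
      obtain ⟨y, hy⟩ := hC A (Finset.mem_erase.2 ⟨hAG, hA⟩)
      rw [Finset.mem_inter] at hy
      have hyc : y ≠ c := by
        rintro rfl
        exact hcG (h A hA hAF (Finset.mem_inter.2 ⟨hc.1, hy.1⟩))
      exact ⟨y, by simp [hy.1, hy.2, hyc]⟩
    · refine (Finset.card_insert_le _ _).trans ?_
      rw [Finset.card_erase_add_one hc.2]
      exact hcard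

/-- If a family `N` is connected outside of `G₀`, its traces on `G₀` have a largest member. -/
theorem exists_largest_trace {N : Finset (Finset α)} {G₀ W : Finset α}
    (hl : HasLeaves (insert G₀ N)) (hN : N.Nonempty) (hW : Disjoint G₀ W)
    (hNW : ∀ G ∈ N, (G ∩ W).Nonempty)
    (hconn : ∀ A ⊆ N, A.Nonempty → (N \ A).Nonempty →
      ∃ a ∈ A, ∃ b ∈ N \ A, (a ∩ b ∩ W).Nonempty) :
    ∃ G₁ ∈ N, ∀ G ∈ N, G ∩ G₀ ⊆ G₁ := by
  induction h : N.card using Nat.strong_induction_on generalizing N with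
  | _ n ih =>
  subst h
  have hG₀ : G₀ ∉ N := fun h => by
    have := hNW _ h
    rw [Finset.disjoint_iff_inter_eq_empty.1 hW] at this
    simp at this
  obtain ⟨F, hF, h⟩ := hl _ subset_rfl (Finset.insert_nonempty _ _)
  rcases h with h | ⟨J, hJ, hJF, h⟩
  · obtain ⟨G, hG⟩ := hN
    have h1 : G = F := by simpa [h] using Finset.mem_insert_of_mem (b := G₀) hG
    have h2 : G₀ = F := by simpa [h] using Finset.mem_insert_self G₀ N
    exact absurd (h2.trans h1.symm ▸ hG) hG₀
  rcases Finset.mem_insert.1 hF with rfl | hFN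
  · refine ⟨J, (Finset.mem_insert.1 hJ).resolve_left hJF, fun G hG => ?_⟩
    rw [Finset.inter_comm]
    exact h G (Finset.mem_insert_of_mem hG) (fun e => hG₀ (e ▸ hG))
  have hFG₀ : G₀ ≠ F := fun e => hG₀ (e ▸ hFN)
  rcases Finset.mem_insert.1 hJ with rfl | hJN
  · have hsing : N \ {F} = ∅ := by
      by_contra hne
      obtain ⟨a, ha, b, hb, x, hx⟩ := hconn {F} (by simpa using hFN) (by simp)
        (Finset.nonempty_iff_ne_empty.2 hne)
      obtain rfl := Finset.mem_singleton.1 ha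
      simp only [Finset.mem_sdiff, Finset.mem_singleton] at hb
      simp only [Finset.mem_inter] at hx
      exact Finset.disjoint_left.1 hW
        (h b (Finset.mem_insert_of_mem hb.1) hb.2 (Finset.mem_inter.2 hx.1)) hx.2
    refine ⟨F, hFN, fun G hG => ?_⟩
    have : G = F := by
      by_contra hne
      have : G ∈ N \ {F} := by simp [hG, hne]
      simp [hsing] at this
    exact this ▸ Finset.inter_subset_left
  · have hJe : J ∈ N.erase F := Finset.mem_erase.2 ⟨hJF, hJN⟩
    -- The joint `J` inherits all links of `F` to other members, so deleting `F` keeps the family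
    -- connected.
    have key : ∀ b ∈ N, b ≠ F → ∀ x ∈ F, x ∈ b → x ∈ J := fun b hb hbF x hx hxb =>
      h b (Finset.mem_insert_of_mem hb) hbF (Finset.mem_inter.2 ⟨hx, hxb⟩)
    obtain ⟨G₁, hG₁, h₁⟩ := ih _ (Finset.card_erase_lt_of_mem hFN)
      (hl.mono (Finset.insert_subset_insert _ (Finset.erase_subset _ _))) ⟨J, hJe⟩
      (fun G hG => hNW G (Finset.mem_of_mem_erase hG)) (by
        intro A hA hAne hBne
        by_cases hJA : J ∈ A
        · obtain ⟨a, ha, b, hb, x, hx⟩ := hconn (insert F A)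
            (Finset.insert_subset hFN (hA.trans (Finset.erase_subset _ _))) (by simp)
            (by
              obtain ⟨b, hb⟩ := hBne
              exact ⟨b, by simp at hb ⊢; tauto⟩)
          simp only [Finset.mem_sdiff, Finset.mem_insert, not_or, Finset.mem_inter] at ha hb hx
          have hb' : b ∈ N.erase F \ A := by simp; tauto
          rcases ha with rfl | ha
          · exact ⟨J, hJA, b, hb', x, by
              have := key b hb.1 hb.2.1 x hx.1.1 hx.1.2
              simp; tauto⟩
          · exact ⟨a, ha, b, hb', x, by simp; tauto⟩
        · obtain ⟨a, ha, b, hb, x, hx⟩ := hconn A (hA.trans (Finset.erase_subset _ _)) hAne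
            ⟨J, by simp [hJN, hJA]⟩
          simp only [Finset.mem_sdiff, Finset.mem_inter] at hb hx
          have haN := Finset.mem_erase.1 (hA ha)
          by_cases hbF : b = F
          · subst hbF
            exact ⟨a, ha, J, by simp [hJN, hJA, hJF], x, by
              have := key a haN.2 haN.1 x hx.1.2 hx.1.1
              simp; tauto⟩
          · exact ⟨a, ha, b, by simp; tauto, x, by simp; tauto⟩) rfl
    refine ⟨G₁, Finset.mem_of_mem_erase hG₁, fun G hG => ?_⟩
    by_cases hGF : G = F
    · subst hGF
      exact (Finset.subset_inter (h G₀ (by simp) hFG₀) Finset.inter_subset_right).trans (h₁ J hJe)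
    · exact h₁ G (Finset.mem_erase.2 ⟨hGF, hG⟩)

/-- In a family with leaves and without singletons, outside of any `G₀` there is a point dominated
by another one. -/
theorem exists_dominated {X G₀ : Finset α}
    (hl : HasLeaves (insert G₀ S)) (hX : ∀ G ∈ S, G ⊆ X) (hc : ∀ G ∈ S, G.card ≠ 1)
    (h2 : 2 ≤ X.card) (h0 : (X \ G₀).Nonempty) :
    ∃ i ∈ X \ G₀, ∃ j ∈ X, j ≠ i ∧ ∀ G ∈ S, i ∈ G → j ∈ G := by
  induction h : S.card using Nat.strong_induction_on generalizing S X G₀ with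
  | _ n ih =>
  subst h
  by_cases hfree : ∃ i ∈ X \ G₀, ∀ G ∈ S, i ∉ G
  · obtain ⟨i, hi, hi'⟩ := hfree
    obtain ⟨j, hj, hji⟩ := Finset.exists_mem_ne h2 i
    exact ⟨i, hi, j, hj, hji, fun G hG h => absurd h (hi' G hG)⟩
  push Not at hfree
  -- `W` is a connected component of the traces outside `G₀`, and `N` below consists of the members
  -- meeting it.
  obtain ⟨W, -, hWmin⟩ := exists_minimal_le_of_wellFoundedLT
    (fun W : Finset α => W.Nonempty ∧ W ⊆ X \ G₀ ∧
      ∀ G ∈ S, (G ∩ W).Nonempty → G \ G₀ ⊆ W) (X \ G₀)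
    ⟨h0, subset_rfl, fun G hG _ => Finset.sdiff_subset_sdiff (hX G hG) subset_rfl⟩
  obtain ⟨⟨⟨w, hw⟩, hWX, hWcl⟩, hWmin⟩ := hWmin
  set N := S.filter (fun G => (G ∩ W).Nonempty) with hN
  have hNS : N ⊆ S := Finset.filter_subset _ _
  have memN : ∀ {G x}, G ∈ S → x ∈ G → x ∈ W → G ∈ N := fun {G x} hG hx hxW =>
    Finset.mem_filter.2 ⟨hG, x, Finset.mem_inter.2 ⟨hx, hxW⟩⟩
  have hNW : ∀ G ∈ N, (G ∩ W).Nonempty := fun G hG => (Finset.mem_filter.1 hG).2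
  have hWG₀ : Disjoint G₀ W := (Finset.disjoint_sdiff).mono_right hWX
  have hNcl : ∀ G ∈ N, ∀ x ∈ G, x ∉ G₀ → x ∈ W := fun G hG x hx hx0 =>
    hWcl G (hNS hG) (hNW G hG) (Finset.mem_sdiff.2 ⟨hx, hx0⟩)
  obtain ⟨G₁, hG₁, hlarge⟩ := exists_largest_trace (N := N) (G₀ := G₀) (W := W)
    (hl.mono (Finset.insert_subset_insert _ hNS))
    (by
      obtain ⟨G, hG, hwG⟩ := hfree w (hWX hw)
      exact ⟨G, memN hG hwG hw⟩) hWG₀ hNW (by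
      intro A hA ⟨a, ha⟩ ⟨b, hb⟩
      by_contra! hcon
      set W' := W.filter (fun x => ∃ a ∈ A, x ∈ a) with hW'
      have hle : W ≤ W' := by
        refine hWmin ⟨?_, (Finset.filter_subset _ _).trans hWX, ?_⟩ (Finset.filter_subset _ _)
        · obtain ⟨x, hx⟩ := hNW a (hA ha)
          rw [Finset.mem_inter] at hx
          exact ⟨x, Finset.mem_filter.2 ⟨hx.2, a, ha, hx.1⟩⟩
        · rintro G hG ⟨x, hx⟩ y hy
          simp only [hW', Finset.mem_inter, Finset.mem_filter, Finset.mem_sdiff] at hx hy ⊢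
          obtain ⟨hxG, hxW, a', ha', hxa'⟩ := hx
          have hGN := memN hG hxG hxW
          have hGA : G ∈ A := by
            by_contra hGA
            have := hcon a' ha' G (Finset.mem_sdiff.2 ⟨hGN, hGA⟩)
            have hx : x ∈ a' ∩ G ∩ W := by simp; tauto
            rw [this] at hx
            simp at hx
          exact ⟨hNcl G hGN y hy.1 hy.2, G, hGA, hy.1⟩
      obtain ⟨x, hx⟩ := hNW b (Finset.mem_sdiff.1 hb).1
      rw [Finset.mem_inter] at hx
      obtain ⟨-, a', ha', hxa'⟩ := Finset.mem_filter.1 (hle hx.2)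
      have := hcon a' ha' b hb
      have hx : x ∈ a' ∩ b ∩ W := by simp; tauto
      rw [this] at hx
      simp at hx)
  have hlt : (N.erase G₁).card < S.card :=
    (Finset.card_erase_lt_of_mem hG₁).trans_le (Finset.card_le_card hNS)
  have hsub : ∀ G ∈ N, G ⊆ W ∪ G₁ := by
    intro G hG x hx
    by_cases hx0 : x ∈ G₀
    · exact Finset.mem_union_right _ (hlarge G hG (Finset.mem_inter.2 ⟨hx, hx0⟩))
    · exact Finset.mem_union_left _ (hNcl G hG x hx hx0)
  have hcard1 : 2 ≤ G₁.card := by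
    have h1 := hc G₁ (hNS hG₁)
    have h3 : 0 < G₁.card := Finset.card_pos.2 ((hNW G₁ hG₁).mono Finset.inter_subset_left)
    lia
  have hG₁X := hX G₁ (hNS hG₁)
  -- All of `N` lies in `W ∪ G₁`. Recurse on `N` without `G₁`, taking `G₁` as the new `G₀` if it
  -- misses a point of `W`. Either way `i ∈ W`, and `G₁` contains `j` or omits `i`.
  by_cases hWG₁ : W ⊆ G₁
  · obtain ⟨i, hi, j, hj, hji, hij⟩ := ih _ hlt (S := N.erase G₁) (X := G₁) (G₀ := G₀)
      (hl.mono (Finset.insert_subset_insert _ ((Finset.erase_subset _ _).trans hNS)))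
      (fun G hG => by
        simpa [Finset.union_eq_right.2 hWG₁] using hsub G (Finset.mem_of_mem_erase hG))
      (fun G hG => hc G (hNS (Finset.mem_of_mem_erase hG))) hcard1
      ⟨w, Finset.mem_sdiff.2 ⟨hWG₁ hw, Finset.disjoint_right.1 hWG₀ hw⟩⟩ rfl
    rw [Finset.mem_sdiff] at hi
    have hiW := hNcl G₁ hG₁ i hi.1 hi.2
    refine ⟨i, hWX hiW, j, hG₁X hj, hji, fun G hG hiG => ?_⟩
    by_cases hGG : G = G₁
    · exact hGG ▸ hj
    · exact hij G (Finset.mem_erase.2 ⟨hGG, memN hG hiG hiW⟩) hiG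
  · obtain ⟨v, hv, hvG⟩ := Finset.not_subset.1 hWG₁
    obtain ⟨i, hi, j, hj, hji, hij⟩ := ih _ hlt (S := N.erase G₁) (X := W ∪ G₁) (G₀ := G₁)
      (hl.mono ((Finset.insert_erase hG₁).subset.trans
        (hNS.trans (Finset.subset_insert _ _))))
      (fun G hG => hsub G (Finset.mem_of_mem_erase hG))
      (fun G hG => hc G (hNS (Finset.mem_of_mem_erase hG)))
      (hcard1.trans (Finset.card_le_card Finset.subset_union_right))
      ⟨v, by simp [hv, hvG]⟩ rfl
    rw [Finset.mem_sdiff, Finset.mem_union] at hi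
    have hiW : i ∈ W := hi.1.resolve_right hi.2
    refine ⟨i, hWX hiW, j, ?_, hji, fun G hG hiG => ?_⟩
    · rcases Finset.mem_union.1 hj with hj | hj
      · exact (Finset.mem_sdiff.1 (hWX hj)).1
      · exact hG₁X hj
    · have hGG : G ≠ G₁ := fun e => hi.2 (e ▸ hiG)
      exact hij G (Finset.mem_erase.2 ⟨hGG, memN hG hiG hiW⟩) hiG

/-- Otherwise `F`, `G₁`, `H`, `G₂` would form a cycle, and either it or a triangle in it would have
no leaf. -/
theorem not_subset_union_of_incomparable (hS : HasLeaves S)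
    (hanti : ∀ F ∈ S, ∀ G ∈ S, F ⊆ G → F = G) {F G₁ G₂ H : Finset α} (hF : F ∈ S)
    (hG₁ : G₁ ∈ S) (hG₂ : G₂ ∈ S) (hH : H ∈ S) {a b : α} (haF : a ∈ F) (hbF : b ∈ F)
    (ha₁ : a ∈ G₁) (ha₂ : a ∉ G₂) (hb₂ : b ∈ G₂) (hb₁ : b ∉ G₁) (haH : a ∉ H) (hbH : b ∉ H) :
    ¬ H ⊆ G₁ ∪ G₂ := by
  intro hsub
  have hHF : ¬ H ⊆ F := fun h => haH (hanti H hH F hF h ▸ haF)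
  have hH₁ : ¬ H ⊆ G₁ := fun h => haH (hanti H hH G₁ hG₁ h ▸ ha₁)
  have hH₂ : ¬ H ⊆ G₂ := fun h => hbH (hanti H hH G₂ hG₂ h ▸ hb₂)
  have n1 : F ≠ G₁ := fun e => hb₁ (e ▸ hbF)
  have n2 : F ≠ G₂ := fun e => ha₂ (e ▸ haF)
  have n3 : F ≠ H := fun e => haH (e ▸ haF)
  have n4 : G₁ ≠ G₂ := fun e => ha₂ (e ▸ ha₁)
  have n5 : G₁ ≠ H := fun e => haH (e ▸ ha₁)
  have n6 : G₂ ≠ H := fun e => hbH (e ▸ hb₂)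
  -- Under these conditions each pair among `F`, `G`, `H` has a common point outside the third, so
  -- none is a leaf.
  have triangle : ∀ {G G' : Finset α} {c : α}, G ∈ S → F ≠ G → G ≠ H → ¬ H ⊆ G →
      H ⊆ G' ∪ G → G' ∩ H ⊆ F → c ∈ F → c ∈ G → c ∉ H → False := by
    intro G G' c hG m1 m2 hHG hsub hG' hcF hcG hcH
    obtain ⟨A, hA, h⟩ := hS {F, G, H} (by
      intro x; simp only [Finset.mem_insert, Finset.mem_singleton]
      rintro (rfl | rfl | rfl) <;> assumption) (by simp)
    have hex : ∃ J ∈ ({F, G, H} : Finset (Finset α)), J ≠ A ∧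
        ∀ B ∈ ({F, G, H} : Finset (Finset α)), B ≠ A → A ∩ B ⊆ J := by
      rcases h with h | h
      · have e1 : F = A := by simpa [h] using Finset.mem_insert_self F {G, H}
        have e2 : G = A := by
          have : G ∈ ({F, G, H} : Finset (Finset α)) := by simp
          simpa [h] using this
        exact absurd (e1.trans e2.symm) m1
      · exact h
    obtain ⟨J, hJ, hJA, h⟩ := hex
    simp only [Finset.subset_iff, Finset.mem_insert, Finset.mem_singleton, Finset.mem_inter,
      Finset.mem_union, not_forall] at *
    have hF' := h F (by simp)
    have hG'' := h G (by simp)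
    have hH' := h H (by simp)
    rcases hA with rfl | rfl | rfl <;> rcases hJ with rfl | rfl | rfl <;> grind
  obtain ⟨A, hA, h⟩ := hS {F, G₁, G₂, H} (by
    intro x; simp only [Finset.mem_insert, Finset.mem_singleton]
    rintro (rfl | rfl | rfl | rfl) <;> assumption) (by simp)
  have hex : ∃ J ∈ ({F, G₁, G₂, H} : Finset (Finset α)), J ≠ A ∧
      ∀ B ∈ ({F, G₁, G₂, H} : Finset (Finset α)), B ≠ A → A ∩ B ⊆ J := by
    rcases h with h | h
    · have e1 : F = A := by simpa [h] using Finset.mem_insert_self F {G₁, G₂, H}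
      have e2 : G₁ = A := by
        have : G₁ ∈ ({F, G₁, G₂, H} : Finset (Finset α)) := by simp
        simpa [h] using this
      exact absurd (e1.trans e2.symm) n1
    · exact h
  obtain ⟨J, hJ, hJA, h⟩ := hex
  have t1 : ¬ G₁ ∩ H ⊆ F := fun hs =>
    triangle hG₂ n2 n6 hH₂ hsub hs hbF hb₂ hbH
  have t2 : ¬ G₂ ∩ H ⊆ F := fun hs =>
    triangle hG₁ n1 n5 hH₁ (by rwa [Finset.union_comm]) hs haF ha₁ haH
  have hF' := h F (by simp)
  have hG₁' := h G₁ (by simp)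
  have hG₂' := h G₂ (by simp)
  have hH' := h H (by simp)
  simp only [Finset.mem_insert, Finset.mem_singleton] at hA hJ
  clear triangle h hanti
  simp only [Finset.subset_iff, Finset.mem_inter, Finset.mem_union, not_forall] at *
  rcases hA with rfl | rfl | rfl | rfl <;> rcases hJ with rfl | rfl | rfl | rfl <;> grind

end HasLeaves


/-! ### Depth is bounded by the dimension of associated primes. -/

section Depth

variable {R : Type*} [CommRing R] [IsNoetherianRing R]

/-- If `x` is regular on `M` and lies in a prime `m` containing an associated prime `P` of `M`,
then `M / xM` has an associated prime between `P + (x)` and `m`. -/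
theorem IsAssociatedPrime.exists_quotSMulTop {M : Type*} [AddCommGroup M] [Module R M]
    [Module.Finite R M] {P m : Ideal R} [hm : m.IsPrime] {x : R} (hx : IsSMulRegular M x)
    (hxm : x ∈ m) (hP : IsAssociatedPrime P M) (hPm : P ≤ m) :
    ∃ Q : Ideal R, IsAssociatedPrime Q (QuotSMulTop x M) ∧ P ≤ Q ∧ x ∈ Q ∧ Q ≤ m := by
  -- `N` is the submodule killed by `P`. As `x` is regular on `M`, `N/xN` embeds in `M/xM`; `Q` is a
  -- minimal prime over its annihilator.
  set N := Submodule.torsionBySet R M P with hN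
  obtain ⟨-, y, hy⟩ := isAssociatedPrime_iff.1 hP
  have hyP : ∀ r, r ∈ P ↔ r • y = 0 := by
    intro r
    rw [hy, Submodule.mem_colon_singleton, Submodule.mem_bot]
  have hyN : y ∈ N := (Submodule.mem_torsionBySet_iff _ _).2 fun a => (hyP a).1 a.2
  have hann : Module.annihilator R N ≤ m := by
    intro r hr
    rw [Module.mem_annihilator] at hr
    have := hr ⟨y, hyN⟩
    exact hPm ((hyP r).2 (by simpa using congrArg Subtype.val this))
  have hsupp : (⟨m, hm⟩ : PrimeSpectrum R) ∈ Module.support R (QuotSMulTop x N) := by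
    rw [Module.support_quotSMulTop]
    exact ⟨Module.mem_support_iff_of_finite.2 hann, by simpa using hxm⟩
  obtain ⟨Q, hQ, hQm⟩ := Ideal.exists_minimalPrimes_le (Module.mem_support_iff_of_finite.1 hsupp)
  have hQN := Module.associatedPrimes.minimalPrimes_annihilator_subset_associatedPrimes R _ hQ
  have hinj : Function.Injective (QuotSMulTop.map x N.subtype) := by
    rw [injective_iff_map_eq_zero]
    intro z hz
    obtain ⟨n, rfl⟩ := Submodule.Quotient.mk_surjective _ z
    rw [QuotSMulTop.map_apply_mk, Submodule.Quotient.mk_eq_zero,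
      Submodule.mem_smul_pointwise_iff_exists] at hz
    obtain ⟨k, -, hk⟩ := hz
    have hkN : k ∈ N := by
      refine (Submodule.mem_torsionBySet_iff _ _).2 fun a => ?_
      apply hx
      have := (Submodule.mem_torsionBySet_iff _ _).1 n.2 a
      simp only [smul_zero]
      rw [smul_comm, hk]
      exact this
    rw [Submodule.Quotient.mk_eq_zero, Submodule.mem_smul_pointwise_iff_exists]
    exact ⟨⟨k, hkN⟩, trivial, Subtype.ext hk⟩
  refine ⟨Q, hQN.map_of_injective _ hinj, fun p hp => ?_, ?_, hQm⟩
  · refine hQ.1.2 (Module.mem_annihilator.2 fun z => ?_)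
    obtain ⟨n, rfl⟩ := Submodule.Quotient.mk_surjective _ z
    rw [← Submodule.Quotient.mk_smul]
    have : p • n = 0 := Subtype.ext ((Submodule.mem_torsionBySet_iff _ _).1 n.2 ⟨p, hp⟩)
    rw [this, Submodule.Quotient.mk_zero]
  · refine hQ.1.2 (Module.mem_annihilator.2 fun z => ?_)
    obtain ⟨n, rfl⟩ := Submodule.Quotient.mk_surjective _ z
    rw [← Submodule.Quotient.mk_smul, Submodule.Quotient.mk_eq_zero]
    exact Submodule.smul_mem_pointwise_smul _ _ _ trivial

/-- Each regular element forces a strict step up to an associated prime of the quotient, since a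
regular element avoids `P`. -/
theorem RingTheory.Sequence.IsWeaklyRegular.length_le_coheight {M : Type*} [AddCommGroup M]
    [Module R M] [Module.Finite R M] {rs : List R}
    (hrs : RingTheory.Sequence.IsWeaklyRegular M rs) {m : Ideal R} [m.IsPrime]
    (hm : ∀ r ∈ rs, r ∈ m) {P : Ideal R} (hP : IsAssociatedPrime P M) (hPm : P ≤ m) :
    (rs.length : ℕ∞) ≤ Order.coheight (⟨P, hP.isPrime⟩ : PrimeSpectrum R) := by
  induction rs generalizing M P with
  | nil => simp
  | cons x rs ih =>
    rw [isWeaklyRegular_cons_iff] at hrs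
    obtain ⟨Q, hQ, hPQ, hxQ, hQm⟩ := hP.exists_quotSMulTop hrs.1 (hm x (by simp)) hPm
    have h := ih hrs.2 (fun r hr => hm r (by simp [hr])) hQ hQm
    have hlt : (⟨P, hP.isPrime⟩ : PrimeSpectrum R) < ⟨Q, hQ.isPrime⟩ := by
      refine lt_of_le_of_ne hPQ fun e => ?_
      have e' : P = Q := congrArg PrimeSpectrum.asIdeal e
      obtain ⟨-, y, hy⟩ := isAssociatedPrime_iff.1 hP
      have hxP : x • y = 0 := by
        have : x ∈ P := e' ▸ hxQ
        rwa [hy, Submodule.mem_colon_singleton, Submodule.mem_bot] at this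
      have hy0 : y = 0 := hrs.1 (by simpa using hxP)
      apply hP.isPrime.ne_top
      rw [hy, hy0]
      simp
    simp only [List.length_cons, Nat.cast_add, Nat.cast_one]
    exact (by gcongr : _ ≤ _).trans (Order.coheight_add_one_le hlt)

theorem quotientDepth_le_ringKrullDim {m I P : Ideal R} {m' : Ideal R} [m'.IsPrime] (hm : m ≤ m')
    (hP : IsAssociatedPrime P (R ⧸ I)) (hPm : P ≤ m') :
    ((quotientDepth m I : ℕ∞) : WithBot ℕ∞) ≤ ringKrullDim (R ⧸ P) := by
  have h : quotientDepth m I ≤ Order.coheight (⟨P, hP.isPrime⟩ : PrimeSpectrum R) :=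
    iSup_le fun rs => iSup_le fun h => iSup_le fun hrs =>
      hrs.toIsWeaklyRegular.length_le_coheight (fun r hr => hm (h r hr)) hP hPm
  rw [ringKrullDim_quotient]
  refine (WithBot.coe_le_coe.2 h).trans ?_
  rw [Order.coheight_eq_krullDim_Ici]
  exact le_of_eq rfl

end Depth

/-! ### Vertex covers, monomial primes and unmixedness. -/

namespace MvPolynomial

variable {V K : Type*} [Field K]

open Classical in
/-- The projection of a polynomial ring onto the polynomial ring in the variables outside of `C`. -/
noncomputable def killVars (K : Type*) [Field K] (C : Finset V) :
    MvPolynomial V K →ₐ[K] MvPolynomial {i // i ∉ C} K :=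
  aeval fun i => if h : i ∈ C then 0 else X ⟨i, h⟩

theorem killVars_X_of_mem {C : Finset V} {i : V} (h : i ∈ C) : killVars K C (X i) = 0 := by
  simp [killVars, h]

theorem killVars_X_of_notMem {C : Finset V} {i : V} (h : i ∉ C) :
    killVars K C (X i) = X ⟨i, h⟩ := by
  simp [killVars, h]

theorem killVars_rename (C : Finset V) (p : MvPolynomial {i // i ∉ C} K) :
    killVars K C (rename Subtype.val p) = p := by
  have : (killVars K C).comp (rename Subtype.val) = AlgHom.id K _ := by
    ext i
    simp [killVars_X_of_notMem i.2]
  exact DFunLike.congr_fun this p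

theorem killVars_surjective (C : Finset V) : Function.Surjective (killVars K C) :=
  fun p => ⟨_, killVars_rename C p⟩

theorem constantCoeff_killVars (C : Finset V) (p : MvPolynomial V K) :
    constantCoeff (killVars K C p) = constantCoeff p := by
  have : (constantCoeff : MvPolynomial {i // i ∉ C} K →+* K).comp (killVars K C).toRingHom =
      constantCoeff := by
    ext i
    · simp
    · by_cases h : i ∈ C
      · simp [killVars_X_of_mem h]
      · simp [killVars_X_of_notMem h]
  exact DFunLike.congr_fun this p

/-- Reduction modulo `J` factors through `killVars`, as can be checked on variables. -/
theorem ker_killVars_le {C : Finset V} {J : Ideal (MvPolynomial V K)}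
    (h : ∀ i ∈ C, (X i : MvPolynomial V K) ∈ J) : RingHom.ker (killVars K C) ≤ J := by
  intro p hp
  have : ((Ideal.Quotient.mkₐ K J).comp (rename Subtype.val)).comp (killVars K C) =
      Ideal.Quotient.mkₐ K J := by
    ext i
    by_cases hi : i ∈ C
    · simp only [AlgHom.comp_apply, killVars_X_of_mem hi, map_zero]
      exact (Ideal.Quotient.eq_zero_iff_mem.2 (h i hi)).symm
    · simp [killVars_X_of_notMem hi]
  have h2 := DFunLike.congr_fun this p
  rw [AlgHom.comp_apply, (RingHom.mem_ker).1 hp, map_zero] at h2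
  exact Ideal.Quotient.eq_zero_iff_mem.1 h2.symm

theorem ringKrullDim_compl [Fintype V] (K : Type*) [Field K] (C : Finset V) :
    ringKrullDim (MvPolynomial {i // i ∉ C} K) = ((Fintype.card V - C.card : ℕ) : WithBot ℕ∞) := by
  classical
  rw [MvPolynomial.ringKrullDim_of_isNoetherianRing, ringKrullDim_eq_zero_of_field, zero_add,
    Nat.card_eq_fintype_card, Fintype.card_subtype_compl, Fintype.card_coe]

end MvPolynomial

namespace PreAbstractSimplicialComplex

open MvPolynomial

variable {V : Type*} [DecidableEq V] {K : Type*} [Field K]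
  {Δ : PreAbstractSimplicialComplex V} {C : Finset V}

theorem facetIdeal_le_ker_killVars (hC : ∀ F ∈ Δ.facets, (F ∩ C).Nonempty) :
    Δ.facetIdeal K ≤ RingHom.ker (killVars K C) := by
  rw [facetIdeal, Ideal.span_le]
  rintro _ ⟨F, hF, rfl⟩
  obtain ⟨x, hx⟩ := hC F hF
  rw [Finset.mem_inter] at hx
  simp only [SetLike.mem_coe, RingHom.mem_ker, map_prod]
  exact Finset.prod_eq_zero hx.1 (killVars_X_of_mem hx.2)

variable [Fintype V]

/-- The prime generated by a minimal vertex cover is associated to the facet ideal. -/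
theorem isAssociatedPrime_ker_killVars (hC : ∀ F ∈ Δ.facets, (F ∩ C).Nonempty)
    (hmin : ∀ c ∈ C, ∃ F ∈ Δ.facets, F ∩ C = {c}) :
    IsAssociatedPrime (RingHom.ker (killVars K C)) (MvPolynomial V K ⧸ Δ.facetIdeal K) := by
  -- The prime is the annihilator of the product of the variables outside `C`. A facet meeting `C`
  -- only in `c` divides `X c` times that product; conversely the product survives in the domain
  -- where `C` is killed.
  refine isAssociatedPrime_iff.2 ⟨RingHom.ker_isPrime _,
    Ideal.Quotient.mk _ (∏ i ∈ Cᶜ, (X i : MvPolynomial V K)), le_antisymm ?_ ?_⟩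
  · refine ker_killVars_le fun c hc => ?_
    obtain ⟨F, hF, hFC⟩ := hmin c hc
    rw [Submodule.mem_colon_singleton, Submodule.mem_bot]
    change Ideal.Quotient.mk _ (X c * ∏ i ∈ Cᶜ, X i) = 0
    rw [Ideal.Quotient.eq_zero_iff_mem]
    have hsub : F ⊆ insert c Cᶜ := by
      intro x hx
      by_cases hxC : x ∈ C
      · have : x ∈ F ∩ C := Finset.mem_inter.2 ⟨hx, hxC⟩
        rw [hFC, Finset.mem_singleton] at this
        simp [this]
      · simp [hxC]
    rw [← Finset.prod_insert (f := fun i => (X i : MvPolynomial V K)) (by simpa using hc)]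
    exact Ideal.mem_of_dvd _ (Finset.prod_dvd_prod_of_subset _ _ _ hsub)
      (Ideal.subset_span ⟨F, hF, rfl⟩)
  · intro p hp
    rw [Submodule.mem_colon_singleton, Submodule.mem_bot] at hp
    change Ideal.Quotient.mk _ (p * ∏ i ∈ Cᶜ, X i) = 0 at hp
    rw [Ideal.Quotient.eq_zero_iff_mem] at hp
    have h := facetIdeal_le_ker_killVars hC hp
    rw [RingHom.mem_ker, map_mul, mul_eq_zero] at h
    refine h.resolve_right ?_
    rw [map_prod]
    refine Finset.prod_ne_zero_iff.2 ?_
    intro i hi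
    rw [killVars_X_of_notMem (by simpa using hi)]
    exact X_ne_zero _

/-- Cohen-Macaulay complexes are unmixed: no minimal vertex cover is larger than another cover. -/
theorem card_le_card_of_isCohenMacaulayQuotient
    (hCM : IsCohenMacaulayQuotient (Δ.facetIdeal K)) {D : Finset V}
    (hD : ∀ F ∈ Δ.facets, (F ∩ D).Nonempty) (hC : ∀ F ∈ Δ.facets, (F ∩ C).Nonempty)
    (hmin : ∀ c ∈ C, ∃ F ∈ Δ.facets, F ∩ C = {c}) : C.card ≤ D.card := by
  have h1 : ringKrullDim (MvPolynomial {i // i ∉ D} K) ≤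
      ringKrullDim (MvPolynomial V K ⧸ Δ.facetIdeal K) :=
    ringKrullDim_le_of_surjective
      (Ideal.Quotient.lift _ (killVars K D).toRingHom
        (fun a ha => facetIdeal_le_ker_killVars (K := K) hD ha))
      (Ideal.Quotient.lift_surjective_of_surjective _ _ (killVars_surjective D))
  have hprime : (RingHom.ker (constantCoeff : MvPolynomial V K →+* K)).IsPrime :=
    RingHom.ker_isPrime _
  have h2 := quotientDepth_le_ringKrullDim (m := idealOfVars V K)
    (m' := RingHom.ker (constantCoeff : MvPolynomial V K →+* K))
    (by
      rw [Ideal.span_le]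
      rintro _ ⟨i, rfl⟩
      simp [RingHom.mem_ker])
    (isAssociatedPrime_ker_killVars (K := K) hC hmin)
    (fun p hp => by
      rw [RingHom.mem_ker] at hp ⊢
      rw [← constantCoeff_killVars C, hp, map_zero])
  rw [ringKrullDim_eq_of_ringEquiv
    (Ideal.quotientKerAlgEquivOfSurjective (killVars_surjective C)).toRingEquiv,
    ringKrullDim_compl] at h2
  rw [ringKrullDim_compl] at h1
  have h3 := (h1.trans_eq hCM.symm).trans h2
  have h4 : Fintype.card V - D.card ≤ Fintype.card V - C.card := by exact_mod_cast h3
  have := C.card_le_univ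
  have := D.card_le_univ
  lia

end PreAbstractSimplicialComplex


/-! ### Structure of unmixed forests. -/

section Unmixed

variable {V : Type*} [DecidableEq V] {S : Finset (Finset V)}

/-- The complement of `I` is a cover; shrink it to a minimal one. -/
theorem exists_minimal_isVertexCover [Fintype V] {I : Finset V} (hI : ∀ F ∈ S, ¬ F ⊆ I) :
    ∃ C, IsVertexCover S C ∧ (∀ c ∈ C, ∃ F ∈ S, F ∩ C = {c}) ∧ Disjoint I C := by
  have hcover : IsVertexCover S Iᶜ := fun F hF => by
    obtain ⟨x, hx, hxI⟩ := Finset.not_subset.1 (hI F hF)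
    exact ⟨x, by simp [hx, hxI]⟩
  obtain ⟨C, hCI, hC, hmin⟩ := exists_minimal_le_of_wellFoundedLT (IsVertexCover S) Iᶜ hcover
  refine ⟨C, hC, fun c hc => ?_, disjoint_compl_right.mono_right hCI⟩
  by_contra! hcon
  have hle := hmin (y := C.erase c) (fun F hF => ?_) (Finset.erase_subset _ _)
  · exact absurd (hle hc) (by simp)
  obtain ⟨x, hx⟩ := hC F hF
  by_contra hemp
  refine hcon F hF (Finset.eq_singleton_iff_unique_mem.2 ?_)
  have huniq : ∀ y ∈ F ∩ C, y = c := by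
    intro y hy
    by_contra hyc
    rw [Finset.mem_inter] at hy
    exact hemp ⟨y, by simp [hy.1, hy.2, hyc]⟩
  exact ⟨huniq x hx ▸ hx, huniq⟩

/-- A vertex cover of the size of a matching meets each edge of the matching once, and consists of
vertices of the matching. -/
theorem IsVertexCover.of_card_le_matching {M : Finset (Finset V)} {C : Finset V} (hMS : M ⊆ S)
    (hM : ∀ F ∈ M, ∀ G ∈ M, ∀ x ∈ F, x ∈ G → F = G) (hC : IsVertexCover S C)
    (hcard : C.card ≤ M.card) :
    (∀ F ∈ M, ∀ a ∈ F, ∀ b ∈ F, a ∈ C → b ∈ C → a = b) ∧ ∀ c ∈ C, ∃ F ∈ M, c ∈ F := by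
  rcases isEmpty_or_nonempty V
  · exact ⟨fun _ _ a => isEmptyElim a, fun c => isEmptyElim c⟩
  choose! p hp using fun F (hF : F ∈ M) => hC F (hMS hF)
  simp only [Finset.mem_inter] at hp
  have hinj : Set.InjOn p M := fun F hF G hG e =>
    hM F hF G hG (p F) (hp F hF).1 (e ▸ (hp G hG).1)
  have heq : M.image p = C := by
    refine Finset.eq_of_subset_of_card_le (fun x hx => ?_) ?_
    · obtain ⟨F, hF, rfl⟩ := Finset.mem_image.1 hx
      exact (hp F hF).2
    · rwa [Finset.card_image_of_injOn hinj]
  have hex : ∀ c ∈ C, ∃ F ∈ M, p F = c := fun c hc => by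
    rw [← heq] at hc
    exact Finset.mem_image.1 hc
  have huniq : ∀ F ∈ M, ∀ a ∈ F, a ∈ C → a = p F := by
    intro F hF a ha haC
    obtain ⟨G, hG, rfl⟩ := hex a haC
    rw [hM F hF G hG _ ha (hp G hG).1]
  refine ⟨fun F hF a ha b hb haC hbC => (huniq F hF a ha haC).trans (huniq F hF b hb hbC).symm,
    fun c hc => ?_⟩
  obtain ⟨F, hF, rfl⟩ := hex c hc
  exact ⟨F, hF, (hp F hF).1⟩

/-- An unmixed simplicial forest is partitioned by facets on each of which the traces of the other
facets form a chain. -/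
theorem HasLeaves.exists_partition_of_unmixed [Fintype V] (hS : HasLeaves S) (h0 : ∅ ∉ S)
    (hanti : ∀ F ∈ S, ∀ G ∈ S, F ⊆ G → F = G)
    (hun : ∀ C D, IsVertexCover S D → IsVertexCover S C →
      (∀ c ∈ C, ∃ F ∈ S, F ∩ C = {c}) → C.card ≤ D.card) :
    ∃ M ⊆ S, (∀ F ∈ M, ∀ G ∈ M, ∀ x ∈ F, x ∈ G → F = G) ∧
      (∀ G ∈ S, ∀ x ∈ G, ∃ F ∈ M, x ∈ F) ∧
      ∀ F ∈ M, ∀ G₁ ∈ S, ∀ G₂ ∈ S, F ∩ G₁ ⊆ G₂ ∨ F ∩ G₂ ⊆ G₁ := by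
  obtain ⟨M, hMS, D, hM, hD, hcard⟩ := hS.exists_matching_cover h0
  refine ⟨M, hMS, hM, fun G hG x hx => ?_, fun F hF G₁ hG₁ G₂ hG₂ => ?_⟩
  -- A cover avoiding `G` minus `x` must contain `x`, so `x` lies in a member of `M`.
  · obtain ⟨C, hC, hmin, hdis⟩ := exists_minimal_isVertexCover (S := S) (I := G.erase x)
      (fun F hF h => by
        have := hanti F hF G hG (h.trans (Finset.erase_subset _ _))
        subst this
        exact absurd (h hx) (by simp))
    obtain ⟨y, hy⟩ := hC G hG
    rw [Finset.mem_inter] at hy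
    have hyx : y = x := by
      by_contra hne
      exact Finset.disjoint_left.1 hdis (Finset.mem_erase.2 ⟨hne, hy.1⟩) hy.2
    exact (hC.of_card_le_matching hMS hM ((hun C D hD hC hmin).trans hcard)).2 x (hyx ▸ hy.2)
  · by_contra! hcon
    obtain ⟨⟨a, ha, ha₂⟩, ⟨b, hb, hb₁⟩⟩ :=
      And.intro (Finset.not_subset.1 hcon.1) (Finset.not_subset.1 hcon.2)
    rw [Finset.mem_inter] at ha hb
    -- A cover avoiding `G₁ ∪ G₂` apart from `a`, `b` must contain both, giving two points in the
    -- matching edge `F`.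
    obtain ⟨C, hC, hmin, hdis⟩ := exists_minimal_isVertexCover (S := S)
      (I := ((G₁ ∪ G₂).erase a).erase b) (fun H hH h => by
        refine hS.not_subset_union_of_incomparable hanti (hMS hF) hG₁ hG₂ hH ha.1 hb.1 ha.2 ha₂
          hb.2 hb₁ (fun h' => ?_) (fun h' => ?_)
          (h.trans ((Finset.erase_subset _ _).trans (Finset.erase_subset _ _)))
        · simpa using h h'
        · simpa using h h')
    have hout : ∀ y ∈ C, y ∈ G₁ ∨ y ∈ G₂ → y = a ∨ y = b := by
      intro y hy hyG
      by_contra! hne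
      exact Finset.disjoint_left.1 hdis (by simp [hne.1, hne.2, hyG]) hy
    have haC : a ∈ C := by
      obtain ⟨y, hy⟩ := hC G₁ hG₁
      rw [Finset.mem_inter] at hy
      rcases hout y hy.2 (Or.inl hy.1) with rfl | rfl
      · exact hy.2
      · exact absurd hy.1 hb₁
    have hbC : b ∈ C := by
      obtain ⟨y, hy⟩ := hC G₂ hG₂
      rw [Finset.mem_inter] at hy
      rcases hout y hy.2 (Or.inr hy.1) with rfl | rfl
      · exact absurd hy.1 ha₂
      · exact hy.2
    have := (hC.of_card_le_matching hMS hM ((hun C D hD hC hmin).trans hcard)).1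
      F hF a ha.1 b hb.1 haC hbC
    exact ha₂ (this ▸ hb.2)

theorem HasLeaves.exists_special_leaf_of_unmixed [Fintype V] (hS : HasLeaves S) (h0 : ∅ ∉ S)
    (hne : S.Nonempty) (hanti : ∀ F ∈ S, ∀ G ∈ S, F ⊆ G → F = G)
    (hun : ∀ C D, IsVertexCover S D → IsVertexCover S C →
      (∀ c ∈ C, ∃ F ∈ S, F ∩ C = {c}) → C.card ≤ D.card) :
    ∃ F ∈ S, (S = {F} ∨ ∃ G ∈ S, G ≠ F ∧ ∀ H ∈ S, H ≠ F → F ∩ H ⊆ G) ∧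
      ∀ H ∈ S, ∀ H' ∈ S, H ≠ F → H' ≠ F → (H ∩ H').Nonempty → ((H ∩ H') \ F).Nonempty := by
  obtain ⟨M, hMS, hM, hcov, hchain⟩ := hS.exists_partition_of_unmixed h0 hanti hun
  have hSne : ∀ G ∈ S, G.Nonempty := fun G hG =>
    Finset.nonempty_iff_ne_empty.2 fun e => h0 (e ▸ hG)
  obtain ⟨G, hG⟩ := hne
  obtain ⟨x, hx⟩ := hSne G hG
  obtain ⟨F, hF, -⟩ := hcov G hG x hx
  by_cases hM2 : M.card ≤ 1
  · have hSF : ∀ H ∈ S, H = F := fun H hH => hanti H hH F (hMS hF) fun y hy => by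
      obtain ⟨F', hF', hy'⟩ := hcov H hH y hy
      rwa [← Finset.card_le_one.1 hM2 F' hF' F hF]
    exact ⟨F, hMS hF, Or.inl (Finset.eq_singleton_iff_unique_mem.2 ⟨hMS hF, hSF⟩),
      fun H hH _ _ hHF => absurd (hSF H hH) hHF⟩
  set f : Finset V → Finset (Finset V) := fun G => M.filter fun F => (F ∩ G).Nonempty with hf
  have memf : ∀ {G A}, A ∈ f G ↔ A ∈ M ∧ ∃ y ∈ A, y ∈ G := by
    intro G A
    simp [hf, Finset.Nonempty]
  have common : ∀ A ∈ M, ∀ H ∈ S, ∀ H' ∈ S, A ∈ f H → A ∈ f H' →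
      ∃ y ∈ A, y ∈ H ∧ y ∈ H' := by
    intro A hA H hH H' hH' h h'
    obtain ⟨-, y, hyA, hy⟩ := memf.1 h
    obtain ⟨-, y', hyA', hy'⟩ := memf.1 h'
    rcases hchain A hA H hH H' hH' with hsub | hsub
    · exact ⟨y, hyA, hy, hsub (Finset.mem_inter.2 ⟨hyA, hy⟩)⟩
    · exact ⟨y', hyA', hsub (Finset.mem_inter.2 ⟨hyA', hy'⟩), hy'⟩
  have hl : HasLeaves (insert ∅ ((S \ M).image f)) :=
    ((hS.mono Finset.sdiff_subset).image f fun H hH J hJ H' hH' hsub A hA => by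
      rw [Finset.mem_inter] at hA
      have hAM := (memf.1 hA.1).1
      obtain ⟨y, hyA, hy⟩ := common A hAM H (Finset.mem_sdiff.1 hH).1 H' (Finset.mem_sdiff.1 hH').1
        hA.1 hA.2
      exact memf.2 ⟨hAM, y, hyA, hsub (Finset.mem_inter.2 hy)⟩).insert_empty
  obtain ⟨A, hA, B, hB, hBA, hdom⟩ := hl.exists_dominated (X := M)
    (fun G hG => by
      obtain ⟨G, -, rfl⟩ := Finset.mem_image.1 hG
      exact Finset.filter_subset _ _)
    -- If `G` met only `A` in `M`, it would lie in `A`, hence equal `A` and belong to `M`.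
    (fun G hG h1 => by
      obtain ⟨G, hGM, rfl⟩ := Finset.mem_image.1 hG
      clear hG
      have hG := Finset.mem_sdiff.1 hGM
      obtain ⟨A, hA⟩ := Finset.card_eq_one.1 h1
      have hAM : A ∈ M := (memf.1 (hA ▸ Finset.mem_singleton_self A)).1
      refine hG.2 (hanti G hG.1 A (hMS hAM) (fun y hy => ?_) ▸ hAM)
      obtain ⟨F', hF', hy'⟩ := hcov G hG.1 y hy
      have : F' ∈ f G := memf.2 ⟨hF', y, hy', hy⟩
      rw [hA, Finset.mem_singleton] at this
      rwa [← this]) (by lia) (by simpa using ⟨F, hF⟩)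
  have hAM : A ∈ M := (Finset.mem_sdiff.1 hA).1
  refine ⟨A, hMS hAM, Or.inr ?_, fun H hH H' hH' hHA hHA' ⟨y, hy⟩ => ?_⟩
  -- The traces on `A` form a chain, so a facet with the largest trace is a joint.
  · obtain ⟨J, hJ, hmax⟩ := Finset.exists_max_image (S.erase A) (fun G => (A ∩ G).card)
      ⟨B, Finset.mem_erase.2 ⟨hBA, hMS hB⟩⟩
    rw [Finset.mem_erase] at hJ
    refine ⟨J, hJ.2, hJ.1, fun H hH hHA => ?_⟩
    rcases hchain A hAM H hH J hJ.2 with h | h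
    · exact h
    · rw [← Finset.eq_of_subset_of_card_le (Finset.subset_inter Finset.inter_subset_left h)
        (hmax H (Finset.mem_erase.2 ⟨hHA, hH⟩))]
      exact Finset.inter_subset_right
  · rw [Finset.mem_inter] at hy
    by_cases hyA : y ∈ A
    · have hdom' : ∀ G ∈ S, G ≠ A → y ∈ G → B ∈ f G := fun G hG hGA hyG =>
        hdom _ (Finset.mem_image_of_mem f (Finset.mem_sdiff.2
          ⟨hG, fun hGM => hGA (hM G hGM A hAM y hyG hyA)⟩)) (memf.2 ⟨hAM, y, hyA, hyG⟩)
      obtain ⟨z, hzB, hz⟩ := common B hB H hH H' hH' (hdom' H hH hHA hy.1) (hdom' H' hH' hHA' hy.2)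
      exact ⟨z, Finset.mem_sdiff.2 ⟨Finset.mem_inter.2 hz, fun hzA => hBA (hM B hB A hAM z hzB hzA)⟩⟩
    · exact ⟨y, by simp [hy.1, hy.2, hyA]⟩

end Unmixed

/-! ### From simplicial forests to families with leaves. -/

namespace PreAbstractSimplicialComplex

variable {V : Type*} {Δ : PreAbstractSimplicialComplex V}

theorem nonempty_of_mem_facets {F : Finset V} (hF : F ∈ Δ.facets) : F.Nonempty :=
  (Δ.isRelLowerSet_faces hF.1).1

theorem eq_of_mem_facets_of_subset {F G : Finset V} (hF : F ∈ Δ.facets) (hG : G ∈ Δ.facets)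
    (h : F ⊆ G) : F = G :=
  h.antisymm (hF.2 hG.1 h)

theorem exists_facet_superset [Finite V] {A : Finset V} (hA : A ∈ Δ) : ∃ F ∈ Δ.facets, A ⊆ F := by
  obtain ⟨F, hAF, hF⟩ := exists_maximal_ge_of_wellFoundedGT (fun G => G ∈ Δ) A hA
  exact ⟨F, hF, hAF⟩

/-- The simplicial complex generated by a family of simplices. -/
def generatedBy (S : Set (Finset V)) : PreAbstractSimplicialComplex V where
  faces := {A | A.Nonempty ∧ ∃ F ∈ S, A ⊆ F}
  isRelLowerSet_faces := fun _ ⟨hA, F, hF, hAF⟩ =>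
    ⟨hA, fun _ hBA hB => ⟨hB, F, hF, hBA.trans hAF⟩⟩

theorem facets_generatedBy {S : Set (Finset V)} (hS : S ⊆ Δ.facets) :
    (generatedBy S).facets = S := by
  ext F
  constructor
  · rintro ⟨⟨hF, G, hG, hFG⟩, hmax⟩
    have : G ∈ generatedBy S := ⟨nonempty_of_mem_facets (hS hG), G, hG, subset_rfl⟩
    exact hFG.antisymm (hmax this hFG) ▸ hG
  · intro hF
    refine ⟨⟨nonempty_of_mem_facets (hS hF), F, hF, subset_rfl⟩, ?_⟩
    rintro A ⟨-, G, hG, hAG⟩ hFA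
    rw [eq_of_mem_facets_of_subset (hS hF) (hS hG) (hFA.trans hAG)]
    exact hAG

variable [DecidableEq V] [Finite V]

/-- The facets of the connected component of a facet are the facets reachable from it. -/
theorem isConnectedComponent_generatedBy {F : Finset V} (hF : F ∈ Δ.facets) :
    (generatedBy {G | Relation.ReflTransGen
      (fun H H' => H ∈ Δ.facets ∧ H' ∈ Δ.facets ∧ (H ∩ H').Nonempty) F G}).IsConnectedComponent
        Δ := by
  set r := fun H H' => H ∈ Δ.facets ∧ H' ∈ Δ.facets ∧ (H ∩ H').Nonempty with hr
  set S := {G | Relation.ReflTransGen r F G} with hSdef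
  have hS : S ⊆ Δ.facets := by
    intro G hG
    rcases Relation.ReflTransGen.cases_tail hG with rfl | ⟨H, -, h⟩
    · exact hF
    · exact h.2.1
  have hfac := facets_generatedBy hS
  have hFS : F ∈ S := Relation.ReflTransGen.refl
  have hreach : ∀ {G}, G ∈ S → Relation.ReflTransGen
      (fun H H' => H ∈ S ∧ H' ∈ S ∧ (H ∩ H').Nonempty) F G := by
    intro G hG
    induction hG with
    | refl => exact .refl
    | tail h1 h2 ih => exact ih.tail ⟨h1, h1.tail h2, h2.2.2⟩
  refine ⟨⟨?_, ⟨F, nonempty_of_mem_facets hF, F, hFS, subset_rfl⟩, ?_⟩, ?_⟩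
  · rw [IsSubcomplex, hfac]
    exact hS
  · rw [hfac]
    intro G hG H hH
    have : Std.Symm (fun H H' => H ∈ S ∧ H' ∈ S ∧ (H ∩ H').Nonempty) :=
      ⟨fun A B ⟨hA, hB, hAB⟩ => ⟨hB, hA, by rwa [Finset.inter_comm]⟩⟩
    exact (Relation.ReflTransGen.stdSymm.symm _ _ (hreach hG)).trans (hreach hH)
  · rintro Γ ⟨hΓ, -, hconn⟩ hle A hA
    obtain ⟨B, hB, hAB⟩ := exists_facet_superset hA
    have hFΓ : F ∈ Γ := hle ⟨nonempty_of_mem_facets hF, F, hFS, subset_rfl⟩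
    obtain ⟨F', hF', hFF'⟩ := exists_facet_superset hFΓ
    obtain rfl := eq_of_mem_facets_of_subset hF (hΓ hF') hFF'
    refine ⟨(Γ.isRelLowerSet_faces hA).1, B, ?_, hAB⟩
    exact Relation.ReflTransGen.mono (fun H H' h => ⟨hΓ h.1, hΓ h.2.1, h.2.2⟩) F B
      (hconn F hF' B hB)

/-- A leaf of the part of `T` in one component stays a leaf of `T`: members in other components are
disjoint from it, so any of them serves as a joint if it is alone. -/
theorem IsSimplicialForest.hasLeaves (hΔ : Δ.IsSimplicialForest) {S : Finset (Finset V)}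
    (hS : ∀ F ∈ S, F ∈ Δ.facets) : HasLeaves S := by
  intro T hTS ⟨F₀, hF₀⟩
  have hT : ∀ F ∈ T, F ∈ Δ.facets := fun F hF => hS F (hTS hF)
  set C := {G | Relation.ReflTransGen
      (fun H H' => H ∈ Δ.facets ∧ H' ∈ Δ.facets ∧ (H ∩ H').Nonempty) F₀ G} with hC
  have hcomp := isConnectedComponent_generatedBy (hT F₀ hF₀)
  rw [← hC] at hcomp
  have hCfac : C ⊆ Δ.facets := by
    intro G hG
    rcases Relation.ReflTransGen.cases_tail hG with rfl | ⟨H, -, h⟩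
    · exact hT _ hF₀
    · exact h.2.1
  have hTC : {G | G ∈ T ∧ G ∈ C} ⊆ Δ.facets := fun G hG => hT G hG.1
  have hfac := facets_generatedBy hTC
  obtain ⟨F, hF, h⟩ := (hΔ _ hcomp).2 (generatedBy {G | G ∈ T ∧ G ∈ C})
    (by
      rw [IsSubcomplex, hfac, facets_generatedBy hCfac]
      exact fun G hG => hG.2)
    ⟨F₀, nonempty_of_mem_facets (hT F₀ hF₀), F₀, ⟨hF₀, .refl⟩, subset_rfl⟩
  rw [hfac] at hF h
  have hout : ∀ H ∈ T, H ∉ C → F ∩ H = ∅ := by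
    intro H hH hHC
    by_contra hne
    exact hHC (hF.2.tail ⟨hT F hF.1, hT H hH, Finset.nonempty_iff_ne_empty.2 hne⟩)
  refine ⟨F, hF.1, ?_⟩
  rcases h with h | ⟨G, hG, hGF, h⟩
  · by_cases hTF : T = {F}
    · exact Or.inl hTF
    right
    have hin : ∀ H ∈ T, H ≠ F → H ∉ C := fun H hH hHF hHC => by
      have : H ∈ {G | G ∈ T ∧ G ∈ C} := ⟨hH, hHC⟩
      rw [h] at this
      exact hHF this
    obtain ⟨G, hG, hGF⟩ : ∃ G ∈ T, G ≠ F := by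
      by_contra! hcon
      exact hTF (Finset.eq_singleton_iff_unique_mem.2 ⟨hF.1, hcon⟩)
    exact ⟨G, hG, hGF, fun H hH hHF => by simp [hout H hH (hin H hH hHF)]⟩
  · refine Or.inr ⟨G, hG.1, hGF, fun H hH hHF => ?_⟩
    by_cases hHC : H ∈ C
    · exact (h H ⟨hH, hHC⟩ hHF).trans Finset.inter_subset_right
    · simp [hout H hH hHC]

end PreAbstractSimplicialComplex

theorem lemma2p8 {V : Type*} [Fintype V] [DecidableEq V] (K : Type*) [Field K]
    (Δ : PreAbstractSimplicialComplex V) (hne : Δ.faces.Nonempty)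
    (hforest : Δ.IsSimplicialForest)
    (hCM : IsCohenMacaulayQuotient (Δ.facetIdeal K)) :
    ∃ F : Finset V, Δ.IsSpecialLeaf F := by
  set S : Finset (Finset V) := (Set.toFinite Δ.facets).toFinset with hS
  have memS : ∀ {F}, F ∈ S ↔ F ∈ Δ.facets := by simp [hS]
  obtain ⟨A, hA⟩ := hne
  obtain ⟨F₀, hF₀, -⟩ := PreAbstractSimplicialComplex.exists_facet_superset (Δ := Δ) hA
  obtain ⟨F, hF, hleaf, hspec⟩ :=
    (hforest.hasLeaves fun F hF => memS.1 hF).exists_special_leaf_of_unmixed (S := S)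
      (fun h => by simpa using
        PreAbstractSimplicialComplex.nonempty_of_mem_facets (memS.1 h))
      ⟨F₀, memS.2 hF₀⟩
      (fun F hF G hG =>
        PreAbstractSimplicialComplex.eq_of_mem_facets_of_subset (memS.1 hF) (memS.1 hG))
      (fun C D hD hC hmin =>
        PreAbstractSimplicialComplex.card_le_card_of_isCohenMacaulayQuotient hCM
          (fun F hF => hD F (memS.2 hF)) (fun F hF => hC F (memS.2 hF))
          (fun c hc => by
            obtain ⟨F, hF, h⟩ := hmin c hc
            exact ⟨F, memS.1 hF, h⟩))
  refine ⟨F, ⟨memS.1 hF, ?_⟩, fun H hH H' hH' hHF hHF' =>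
    ⟨fun h => h.mono Finset.sdiff_subset, hspec H (memS.2 hH) H' (memS.2 hH') hHF hHF'⟩⟩
  rcases hleaf with h | ⟨G, hG, hGF, h⟩
  · left
    ext G
    rw [← memS, h]
    simp
  · exact Or.inr ⟨G, memS.1 hG, hGF, fun H hH hHF =>
      Finset.subset_inter Finset.inter_subset_left (h H (memS.2 hH) hHF)⟩
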